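/- Let $q\in\mathbb{C}$ with $|q|<1$ (and $0^0=1$). Then the double series $\sum_{(b,c)\in\mathbb{Z}^2} q^{b^2+bc+c^2}$ and the series $\sum_{m\ge 0}\left(\frac{q^{3m+1}}{1-q^{3m+1}}-\frac{q^{3m+2}}{1-q^{3m+2}}\right)$ converge absolutely, and $$\sum_{b,c\in\mathbb{Z}} q^{b^2+bc+c^2} = 1 + 6\sum_{m=0}^{\infty}\left(\frac{q^{3m+1}}{1-q^{3m+1}}-\frac{q^{3m+2}}{1-q^{3m+2}}\right).$$ -/

import Mathlib

/-! Let r(n) count the representations of n by b² + bc + c², and let χ be the character mod 3.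
Comparing coefficients reduces the identity to r(n) = 6 ∑_{d ∣ n} χ(d) for n ≥ 1 (`ncard_hexRep`).
Both sides satisfy f(pn) = (1 + χ(p)) f(n) - χ(p) f(n/p) for every prime p, with f(n/p) = 0 if p ∤
n, so strong induction from r(1) = 6 suffices; unique factorization of Eisenstein integers is not
needed. For r (`ncard_hexRep_prime_mul`), elements of norm pn are compared with multiples of an
element of norm p, or of p itself, according to p mod 3. For the divisor sum the recursion is
inclusion-exclusion. Expanding the Lambert series by divisors finishes the proof. -/

/-- The nontrivial quadratic character on `ZMod 3`. -/
def chiThree : MulChar (ZMod 3) ℤ where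
  toFun a :=
    match a with
    | 0 => 0
    | 1 => 1
    | 2 => -1
  map_one' := rfl
  map_mul' := by decide
  map_nonunit' := by decide

/-! ### Arithmetic of Eisenstein integers -/

/-- The quadratic form `b² + bc + c²`, the norm form of the Eisenstein integers. -/
def hexNorm (z : ℤ × ℤ) : ℤ := z.1 ^ 2 + z.1 * z.2 + z.2 ^ 2

/-- Multiplication of Eisenstein integers in the basis `1, ζ` with `ζ² = ζ - 1`. -/
def hexMul (w z : ℤ × ℤ) : ℤ × ℤ :=
  (z.1 * w.1 - z.2 * w.2, z.1 * w.2 + z.2 * w.1 + z.2 * w.2)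

/-- Conjugation of Eisenstein integers. -/
def hexConj (w : ℤ × ℤ) : ℤ × ℤ := (w.1 + w.2, -w.2)

/-- The set of representations of `n` by `b² + bc + c²`. -/
def hexRep (n : ℤ) : Set (ℤ × ℤ) := {z | hexNorm z = n}

lemma hexNorm_hexMul (w z : ℤ × ℤ) : hexNorm (hexMul w z) = hexNorm w * hexNorm z := by
  simp only [hexNorm, hexMul]; ring

lemma hexNorm_hexConj (w : ℤ × ℤ) : hexNorm (hexConj w) = hexNorm w := by
  simp only [hexNorm, hexConj]; ring

lemma hexMul_hexConj_hexMul (w z : ℤ × ℤ) :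
    hexMul (hexConj w) (hexMul w z) = (hexNorm w * z.1, hexNorm w * z.2) := by
  simp only [hexNorm, hexMul, hexConj, Prod.mk.injEq]; constructor <;> ring

lemma sq_add_sq_le_two_mul_hexNorm (z : ℤ × ℤ) : z.1 ^ 2 + z.2 ^ 2 ≤ 2 * hexNorm z := by
  simp only [hexNorm]; nlinarith [sq_nonneg (z.1 + z.2)]

lemma hexNorm_nonneg (z : ℤ × ℤ) : 0 ≤ hexNorm z := by
  nlinarith [sq_add_sq_le_two_mul_hexNorm z, sq_nonneg z.1, sq_nonneg z.2]

/-- Gives finiteness of `hexRep n` and, later, geometric domination of the theta series. -/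
lemma abs_add_abs_le_two_mul_hexNorm (z : ℤ × ℤ) : |z.1| + |z.2| ≤ 2 * hexNorm z := by
  have h (a : ℤ) : |a| ≤ a ^ 2 := by
    rw [← sq_abs]; exact Int.le_self_sq _
  linarith [sq_add_sq_le_two_mul_hexNorm z, h z.1, h z.2]

lemma hexNorm_eq_zero_iff (z : ℤ × ℤ) : hexNorm z = 0 ↔ z = 0 := by
  refine ⟨fun h => ?_, fun h => by simp [h, hexNorm]⟩
  have := abs_add_abs_le_two_mul_hexNorm z
  have h1 := abs_nonneg z.1
  have h2 := abs_nonneg z.2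
  exact Prod.ext (abs_eq_zero.mp (by omega)) (abs_eq_zero.mp (by omega))

lemma hexMul_injective {w : ℤ × ℤ} (hw : hexNorm w ≠ 0) : Function.Injective (hexMul w) := by
  intro x y h
  have h' := congrArg (hexMul (hexConj w)) h
  rw [hexMul_hexConj_hexMul, hexMul_hexConj_hexMul, Prod.mk.injEq] at h'
  exact Prod.ext (mul_left_cancel₀ hw h'.1) (mul_left_cancel₀ hw h'.2)

lemma finite_hexRep (n : ℤ) : (hexRep n).Finite := by
  refine (((Set.finite_Icc (-(2 * n)) (2 * n)).prod
    (Set.finite_Icc (-(2 * n)) (2 * n)))).subset fun z hz => ?_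
  have h := abs_add_abs_le_two_mul_hexNorm z
  rw [show hexNorm z = n from hz] at h
  simp only [Set.mem_prod, Set.mem_Icc, ← abs_le]
  constructor <;> linarith [abs_nonneg z.1, abs_nonneg z.2]

lemma ncard_hexRep_one : (hexRep 1).ncard = 6 := by
  have : hexRep 1 =
      (({(1, 0), (-1, 0), (0, 1), (0, -1), (1, -1), (-1, 1)} : Finset (ℤ × ℤ)) :
        Set (ℤ × ℤ)) := by
    ext ⟨b, c⟩
    simp only [hexRep, hexNorm, Set.mem_ofPred_eq, Finset.coe_insert, Finset.coe_singleton,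
      Set.mem_insert_iff, Set.mem_singleton_iff, Prod.mk.injEq]
    constructor
    · intro h
      -- 4(b² + bc + c²) = 3b² + (b + 2c)², so 3b² ≤ 4; likewise for c.
      have h1 : -1 ≤ b ∧ b ≤ 1 := by constructor <;> nlinarith [sq_nonneg (b + 2 * c)]
      have h2 : -1 ≤ c ∧ c ≤ 1 := by constructor <;> nlinarith [sq_nonneg (c + 2 * b)]
      obtain ⟨h1, h1'⟩ := h1
      obtain ⟨h2, h2'⟩ := h2
      interval_cases b <;> interval_cases c <;> simp_all
    · rintro (⟨rfl, rfl⟩ | ⟨rfl, rfl⟩ | ⟨rfl, rfl⟩ | ⟨rfl, rfl⟩ | ⟨rfl, rfl⟩ | ⟨rfl, rfl⟩) <;> norm_num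
  rw [this, Set.ncard_coe_finset]
  rfl

/-- Multiplication by `w` maps representations of `n` to representations of `p * n`. -/
lemma image_hexMul_subset {w : ℤ × ℤ} {p : ℤ} (hw : hexNorm w = p) (n : ℤ) :
    hexMul w '' hexRep n ⊆ hexRep (p * n) := by
  rintro _ ⟨z, hz, rfl⟩
  simp only [hexRep, Set.mem_ofPred_eq] at hz ⊢
  rw [hexNorm_hexMul, hw, hz]

/-- An Eisenstein integer `z` of norm `p * n` is divisible by `w` of norm `p` as soon as `p` divides
both coordinates of `z * conj w`. -/
lemma mem_image_hexMul_iff {w : ℤ × ℤ} {p n : ℤ} (hp : p ≠ 0) (hw : hexNorm w = p) {z : ℤ × ℤ}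
    (hz : z ∈ hexRep (p * n)) :
    z ∈ hexMul w '' hexRep n ↔
      p ∣ z.1 * w.1 + z.1 * w.2 + z.2 * w.2 ∧ p ∣ z.2 * w.1 - z.1 * w.2 := by
  constructor
  · rintro ⟨y, -, rfl⟩
    subst hw
    exact ⟨⟨y.1, by simp only [hexMul, hexNorm]; ring⟩, ⟨y.2, by simp only [hexMul, hexNorm]; ring⟩⟩
  · rintro ⟨⟨x, hx⟩, ⟨y, hy⟩⟩
    have key : hexMul w (x, y) = z := by
      have h : hexMul w (p * x, p * y) = (p * z.1, p * z.2) := by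
        rw [← hx, ← hy, ← hw]
        simp only [hexMul, hexNorm, Prod.mk.injEq]; constructor <;> ring
      simp only [hexMul, Prod.mk.injEq] at h
      refine Prod.ext (mul_left_cancel₀ hp ?_) (mul_left_cancel₀ hp ?_)
      · simp only [hexMul]; linarith [h.1]
      · simp only [hexMul]; linarith [h.2]
    refine ⟨(x, y), ?_, key⟩
    have h2 : hexNorm z = p * n := hz
    rw [← key, hexNorm_hexMul, hw] at h2
    exact mul_left_cancel₀ hp h2

lemma ncard_image_hexMul {w : ℤ × ℤ} (hw : hexNorm w ≠ 0) (n : ℤ) :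
    (hexMul w '' hexRep n).ncard = (hexRep n).ncard :=
  Set.ncard_image_of_injective _ (hexMul_injective hw)

lemma hexNorm_intCast (p : ℤ) : hexNorm (p, 0) = p * p := by simp [hexNorm, sq]

lemma mem_image_hexMul_intCast {p n : ℤ} (hp : p ≠ 0) {z : ℤ × ℤ} (hz : z ∈ hexRep (p * (p * n))) :
    z ∈ hexMul (p, 0) '' hexRep n ↔ p ∣ z.1 ∧ p ∣ z.2 := by
  rw [← mul_assoc] at hz
  rw [mem_image_hexMul_iff (mul_ne_zero hp hp) (hexNorm_intCast p) hz]
  simp [mul_dvd_mul_iff_right hp]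

/-- If `p` divides both coordinates of a representation of `p * n` then `p` divides `n`. -/
lemma dvd_of_mem_hexRep {p n : ℤ} (hp : p ≠ 0) {z : ℤ × ℤ} (hz : z ∈ hexRep (p * n))
    (h1 : p ∣ z.1) (h2 : p ∣ z.2) : p ∣ n := by
  obtain ⟨x, hx⟩ := h1
  obtain ⟨y, hy⟩ := h2
  have h : hexNorm z = p * n := hz
  refine ⟨hexNorm (x, y), mul_left_cancel₀ hp ?_⟩
  rw [← h]
  simp only [hexNorm, hx, hy]; ring

/-- The number of representations of `n / p`, when `p ∣ n`, and `0` otherwise. -/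
noncomputable def hexRepDiv (n p : ℕ) : ℕ := if p ∣ n then (hexRep ((n / p : ℕ) : ℤ)).ncard else 0

/-- Dividing by p lowers the norm by p², so these elements correspond to those of norm n/p. -/
lemma ncard_setOf_dvd {p : ℕ} (hp : p ≠ 0) (n : ℕ) :
    {z ∈ hexRep ((p : ℤ) * n) | (p : ℤ) ∣ z.1 ∧ (p : ℤ) ∣ z.2}.ncard = hexRepDiv n p := by
  have hp' : (p : ℤ) ≠ 0 := by exact_mod_cast hp
  unfold hexRepDiv
  split_ifs with h
  · obtain ⟨m, rfl⟩ := h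
    rw [Nat.mul_div_cancel_left _ (Nat.pos_of_ne_zero hp)]
    have hN : hexNorm ((p : ℤ), 0) ≠ 0 := by rw [hexNorm_intCast]; exact mul_ne_zero hp' hp'
    rw [← ncard_image_hexMul hN]
    congr 1
    ext z
    push_cast
    constructor
    · rintro ⟨hz, h⟩
      exact (mem_image_hexMul_intCast hp' hz).2 h
    · intro h
      have hz := image_hexMul_subset (hexNorm_intCast p) _ h
      rw [mul_assoc] at hz
      exact ⟨hz, (mem_image_hexMul_intCast hp' hz).1 h⟩
  · rw [Set.ncard_eq_zero ((finite_hexRep _).subset (Set.sep_subset _ _))]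
    ext z
    simp only [Set.mem_ofPred_eq, Set.mem_empty_iff_false, iff_false]
    rintro ⟨hz, h1, h2⟩
    exact h (by exact_mod_cast dvd_of_mem_hexRep hp' hz h1 h2)

/-! ### Ramified, inert and split primes -/

lemma ncard_hexRep_three_mul (n : ℕ) : (hexRep (3 * n)).ncard = (hexRep n).ncard := by
  have hw : hexNorm (1, 1) = 3 := by simp [hexNorm]
  rw [← ncard_image_hexMul (w := (1, 1)) (by simp [hw]) n]
  refine congrArg Set.ncard (Set.Subset.antisymm (fun z hz => ?_) (image_hexMul_subset hw _))
  rw [mem_image_hexMul_iff three_ne_zero hw hz]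
  -- The form is (b - c)² + 3bc.
  have h : (3 : ℤ) ∣ (z.2 - z.1) ^ 2 := by
    have hz' : hexNorm z = 3 * n := hz
    refine ⟨n - z.1 * z.2, ?_⟩
    rw [mul_sub, ← hz', hexNorm]; ring
  have := Int.prime_three.dvd_of_dvd_pow h
  simp only
  omega

/-- A nontrivial zero of the form modulo `p ≠ 3` yields a nontrivial cube root of unity. -/
lemma three_dvd_sub_one_of_hexNorm_dvd {p : ℕ} (hp : p.Prime) (hp3 : p ≠ 3) {z : ℤ × ℤ}
    (hz : (p : ℤ) ∣ hexNorm z) (h2 : ¬ (p : ℤ) ∣ z.2) : 3 ∣ p - 1 := by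
  have := Fact.mk hp
  have hc : (z.2 : ZMod p) ≠ 0 := by rwa [Ne, ZMod.intCast_zmod_eq_zero_iff_dvd]
  have h0 : (z.1 : ZMod p) ^ 2 + z.1 * z.2 + z.2 ^ 2 = 0 := by
    have := (ZMod.intCast_zmod_eq_zero_iff_dvd _ p).2 hz
    simpa [hexNorm] using this
  set x : ZMod p := z.1 / z.2 with hx
  have hx0 : x ^ 2 + x + 1 = 0 := by
    rw [hx]; field_simp; linear_combination h0
  have hx3 : x ^ 3 = 1 := by linear_combination (x - 1) * hx0
  have hx1 : x ≠ 1 := by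
    intro h
    rw [h] at hx0
    have h3 : ((3 : ℕ) : ZMod p) = 0 := by push_cast; linear_combination hx0
    rw [ZMod.natCast_eq_zero_iff] at h3
    exact hp3 ((Nat.prime_dvd_prime_iff_eq hp Nat.prime_three).1 h3)
  have hxne : x ≠ 0 := by
    rintro h
    simp [h] at hx3
  have : Fact (Nat.Prime 3) := ⟨Nat.prime_three⟩
  rw [← orderOf_eq_prime hx3 hx1]
  exact orderOf_dvd_of_pow_eq_one (ZMod.pow_card_sub_one_eq_one hxne)

/-- There is no primitive cube root of unity mod p, so p divides both coordinates of any element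
whose norm it divides. -/
lemma ncard_hexRep_inert {p : ℕ} (hp : p.Prime) (h : p % 3 = 2) (n : ℕ) :
    (hexRep ((p : ℤ) * n)).ncard = hexRepDiv n p := by
  rw [← ncard_setOf_dvd hp.ne_zero]
  congr 1
  ext z
  refine ⟨fun hz => ⟨hz, ?_⟩, fun hz => hz.1⟩
  have hz' : hexNorm z = p * n := hz
  have hd : (p : ℤ) ∣ hexNorm z := ⟨n, hz'⟩
  have hd' : (p : ℤ) ∣ hexNorm (z.2, z.1) := by
    convert hd using 1; simp only [hexNorm]; ring
  have := hp.pos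
  constructor
  · by_contra hc
    have := three_dvd_sub_one_of_hexNorm_dvd hp (by omega) hd' hc
    omega
  · by_contra hc
    have := three_dvd_sub_one_of_hexNorm_dvd hp (by omega) hd hc
    omega

/-- Modulo a prime `p ≡ 1 mod 3` there is a root of `x² + x + 1`. -/
lemma exists_sq_add_self_add_one_eq_zero {p : ℕ} [Fact p.Prime] (h : p % 3 = 1) :
    ∃ x : ZMod p, x ^ 2 + x + 1 = 0 := by
  have : Fact (Nat.Prime 3) := ⟨Nat.prime_three⟩
  have hd : 3 ∣ Fintype.card (ZMod p)ˣ := by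
    rw [ZMod.card_units]; omega
  obtain ⟨u, hu⟩ := exists_prime_orderOf_dvd_card 3 hd
  have hu3 : u ^ 3 = 1 := hu ▸ pow_orderOf_eq_one u
  have hu1 : u ≠ 1 := by
    rintro rfl
    simp at hu
  refine ⟨u, ?_⟩
  have h1 : (u : ZMod p) - 1 ≠ 0 := by
    rw [sub_ne_zero]
    simpa using hu1
  have h3 : (u : ZMod p) ^ 3 = 1 := by rw [← Units.val_pow_eq_pow_val, hu3, Units.val_one]
  refine mul_left_cancel₀ h1 ?_
  linear_combination h3

/-- Thue's lemma. -/
lemma exists_ne_zero_sq_lt_of_zmod {p : ℕ} [Fact p.Prime] (x : ZMod p) :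
    ∃ z : ℤ × ℤ, z ≠ 0 ∧ (z.1 : ZMod p) = x * z.2 ∧ z.1 ^ 2 < p ∧ z.2 ^ 2 < p := by
  have hp : p.Prime := Fact.out
  set s := Nat.sqrt p with hs
  have hlt : s * s < p := by
    refine lt_of_le_of_ne (Nat.sqrt_le p) fun h => ?_
    exact hp.prime.not_isSquare ⟨s, h.symm⟩
  -- Pigeonhole: (s + 1)² > p pairs map to p residues.
  let f : Fin (s + 1) × Fin (s + 1) → ZMod p := fun a => (a.1 : ℕ) - x * (a.2 : ℕ)
  obtain ⟨a, b, hab, hf⟩ := Fintype.exists_ne_map_eq_of_card_lt f (by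
    simpa [ZMod.card] using Nat.lt_succ_sqrt p)
  have hsq (i j : Fin (s + 1)) : (((i : ℕ) : ℤ) - (j : ℕ)) ^ 2 < p := by
    have hi : ((i : ℕ) : ℤ) ≤ s := by exact_mod_cast Nat.lt_succ_iff.1 i.2
    have hj : ((j : ℕ) : ℤ) ≤ s := by exact_mod_cast Nat.lt_succ_iff.1 j.2
    have h : ((s : ℤ)) * s < p := by exact_mod_cast hlt
    have : |((i : ℕ) : ℤ) - (j : ℕ)| ≤ s := by
      rw [abs_le]; constructor <;> linarith [Int.natCast_nonneg (i : ℕ), Int.natCast_nonneg (j : ℕ)]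
    nlinarith [sq_le_sq' (abs_le.1 this).1 (abs_le.1 this).2]
  refine ⟨((a.1 : ℕ) - (b.1 : ℕ), (a.2 : ℕ) - (b.2 : ℕ)), fun h => hab ?_, ?_, hsq _ _, hsq _ _⟩
  · simp only [Prod.mk_eq_zero, sub_eq_zero, Nat.cast_inj] at h
    exact Prod.ext (Fin.ext h.1) (Fin.ext h.2)
  · simp only [f] at hf
    push_cast
    linear_combination hf

/-- Primes `p ≡ 1 mod 3` are represented by `u² + uv + v²`. -/
lemma exists_hexNorm_eq_prime {p : ℕ} (hp : p.Prime) (h : p % 3 = 1) :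
    ∃ w : ℤ × ℤ, hexNorm w = p := by
  have := Fact.mk hp
  obtain ⟨x, hx⟩ := exists_sq_add_self_add_one_eq_zero h
  obtain ⟨z, hz0, hz, h1, h2⟩ := exists_ne_zero_sq_lt_of_zmod x
  have hd : (p : ℤ) ∣ hexNorm z := by
    rw [← ZMod.intCast_zmod_eq_zero_iff_dvd]
    simp only [hexNorm]
    push_cast
    rw [hz]
    linear_combination (z.2 : ZMod p) ^ 2 * hx
  obtain ⟨k, hk⟩ := hd
  have hp0 : (0 : ℤ) < p := by exact_mod_cast hp.pos
  have hpos : 0 < hexNorm z :=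
    lt_of_le_of_ne (hexNorm_nonneg z) fun h => hz0 ((hexNorm_eq_zero_iff z).1 h.symm)
  -- bc ≤ (b² + c²)/2 and b², c² < p.
  have hlt : hexNorm z < p * 3 := by
    simp only [hexNorm]; nlinarith [sq_nonneg (z.1 - z.2)]
  rw [hk] at hpos hlt
  have hk0 : 0 < k := pos_of_mul_pos_right hpos hp0.le
  have hk3 : k < 3 := lt_of_mul_lt_mul_left hlt hp0.le
  interval_cases k
  · exact ⟨z, by simpa using hk⟩
  -- Norm 2p is impossible: 2 is inert, so both coordinates are even, which forces 2 ∣ p.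
  · exfalso
    have hodd : ¬ (2 : ℤ) ∣ z.2 → 3 ∣ 2 - 1 :=
      three_dvd_sub_one_of_hexNorm_dvd Nat.prime_two (by norm_num) (by rw [hk]; simp)
    have hodd' : ¬ (2 : ℤ) ∣ z.1 → 3 ∣ 2 - 1 :=
      three_dvd_sub_one_of_hexNorm_dvd (z := (z.2, z.1)) Nat.prime_two (by norm_num) (by
        refine ⟨p, ?_⟩
        push_cast
        rw [mul_comm, ← hk]; simp only [hexNorm]; ring)
    have e2 : (2 : ℤ) ∣ z.2 := by by_contra hc; have := hodd hc; omega
    have e1 : (2 : ℤ) ∣ z.1 := by by_contra hc; have := hodd' hc; omega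
    have h2p : (2 : ℤ) ∣ p :=
      dvd_of_mem_hexRep (z := z) two_ne_zero (by rw [mul_comm]; exact hk) e1 e2
    have h2p' : 2 ∣ p := by exact_mod_cast h2p
    rw [Nat.prime_dvd_prime_iff_eq Nat.prime_two hp] at h2p'
    omega

/-- Here p is `w` times its conjugate. Each element of norm pn is divisible by one of the two, and
by both exactly when p divides it; then inclusion-exclusion. -/
lemma ncard_hexRep_split {p : ℕ} (hp : p.Prime) (h : p % 3 = 1) (n : ℕ) :
    (hexRep ((p : ℤ) * n)).ncard + hexRepDiv n p = 2 * (hexRep n).ncard := by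
  obtain ⟨w, hw⟩ := exists_hexNorm_eq_prime hp h
  have hp0 : (p : ℤ) ≠ 0 := by exact_mod_cast hp.ne_zero
  have hpp : Prime (p : ℤ) := Nat.prime_iff_prime_int.1 hp
  have hw' : hexNorm (hexConj w) = p := by rw [hexNorm_hexConj, hw]
  have hform : w.1 ^ 2 + w.1 * w.2 + w.2 ^ 2 = (p : ℤ) := hw
  have hdvd2 : ¬ ((p : ℤ) ∣ w.1 ∧ (p : ℤ) ∣ w.2) := by
    rintro ⟨h1, h2⟩
    have : (p : ℤ) ∣ 1 := dvd_of_mem_hexRep hp0 (z := w) (by simpa [hexRep] using hw) h1 h2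
    exact hpp.not_dvd_one this
  have hu : ¬ (p : ℤ) ∣ w.1 := fun h1 => hdvd2 ⟨h1, hpp.dvd_of_dvd_pow (n := 2) <| by
    rw [show w.2 ^ 2 = p - w.1 * (w.1 + w.2) by linarith]
    exact dvd_sub_self_left.2 (h1.mul_right _)⟩
  have hv : ¬ (p : ℤ) ∣ w.2 := fun h2 => hdvd2 ⟨hpp.dvd_of_dvd_pow (n := 2) <| by
    rw [show w.1 ^ 2 = p - w.2 * (w.1 + w.2) by linarith]
    exact dvd_sub_self_left.2 (h2.mul_right _), h2⟩
  have huv : ¬ (p : ℤ) ∣ w.1 + w.2 := fun h1 => hv (hpp.dvd_of_dvd_pow (n := 2) <| by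
    rw [show w.2 ^ 2 = p - (w.1 + w.2) * w.1 by linarith]
    exact dvd_sub_self_left.2 (h1.mul_right _))
  -- The trace of `w`: 4p = (2u + v)² + 3v². It separates the two factors of p in `hinter`.
  have htr : ¬ (p : ℤ) ∣ 2 * w.1 + w.2 := by
    intro h1
    have h3 : (p : ℤ) ∣ 3 * w.2 ^ 2 := by
      rw [show 3 * w.2 ^ 2 = p * 4 - (2 * w.1 + w.2) * (2 * w.1 + w.2) by
        rw [← hform]; ring]
      exact dvd_sub (dvd_mul_right _ _) (h1.mul_right _)
    rcases hpp.dvd_or_dvd h3 with h3 | h3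
    · have h3' : p ∣ 3 := by exact_mod_cast h3
      rw [Nat.prime_dvd_prime_iff_eq hp Nat.prime_three] at h3'
      omega
    · exact hv (hpp.dvd_of_dvd_pow h3)
  have mem1 {z : ℤ × ℤ} (hz : z ∈ hexRep (p * n)) :
      z ∈ hexMul w '' hexRep n ↔ (p : ℤ) ∣ z.2 * w.1 - z.1 * w.2 := by
    rw [mem_image_hexMul_iff hp0 hw hz]
    refine ⟨fun h => h.2, fun h => ⟨?_, h⟩⟩
    refine (hpp.dvd_or_dvd (a := w.1) ?_).resolve_left hu
    rw [show w.1 * (z.1 * w.1 + z.1 * w.2 + z.2 * w.2) =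
      p * z.1 + (z.2 * w.1 - z.1 * w.2) * w.2 by rw [← hform]; ring]
    exact dvd_add (dvd_mul_right _ _) (h.mul_right _)
  have mem2 {z : ℤ × ℤ} (hz : z ∈ hexRep (p * n)) :
      z ∈ hexMul (hexConj w) '' hexRep n ↔ (p : ℤ) ∣ z.1 * w.2 + z.2 * (w.1 + w.2) := by
    rw [mem_image_hexMul_iff hp0 hw' hz]
    simp only [hexConj]
    rw [show z.2 * (w.1 + w.2) - z.1 * -w.2 = z.1 * w.2 + z.2 * (w.1 + w.2) by ring]
    refine ⟨fun h => h.2, fun h => ⟨?_, h⟩⟩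
    refine (hpp.dvd_or_dvd (a := w.1 + w.2) ?_).resolve_left huv
    rw [show (w.1 + w.2) * (z.1 * (w.1 + w.2) + z.1 * -w.2 + z.2 * -w.2) =
      p * z.1 - (z.1 * w.2 + z.2 * (w.1 + w.2)) * w.2 by rw [← hform]; ring]
    exact dvd_sub (dvd_mul_right _ _) (h.mul_right _)
  have hunion : hexMul w '' hexRep n ∪ hexMul (hexConj w) '' hexRep n = hexRep (p * n) := by
    refine Set.Subset.antisymm
      (Set.union_subset (image_hexMul_subset hw _) (image_hexMul_subset hw' _)) fun z hz => ?_
    rw [Set.mem_union, mem1 hz, mem2 hz]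
    apply hpp.dvd_or_dvd
    have hz' : z.1 ^ 2 + z.1 * z.2 + z.2 ^ 2 = p * n := hz
    -- The product of the two linear forms is z₂² N(w) - w₂² N(z).
    refine ⟨z.2 ^ 2 - w.2 ^ 2 * n, ?_⟩
    linear_combination z.2 ^ 2 * hform - w.2 ^ 2 * hz'
  have hinter : hexMul w '' hexRep n ∩ hexMul (hexConj w) '' hexRep n =
      {z ∈ hexRep ((p : ℤ) * n) | (p : ℤ) ∣ z.1 ∧ (p : ℤ) ∣ z.2} := by
    ext z
    constructor
    · rintro ⟨h1, h2⟩
      have hz := image_hexMul_subset hw _ h1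
      rw [mem1 hz] at h1
      rw [mem2 hz] at h2
      have hz2 : (p : ℤ) ∣ z.2 := by
        refine (hpp.dvd_or_dvd (b := 2 * w.1 + w.2) ?_).resolve_right htr
        rw [show z.2 * (2 * w.1 + w.2) =
          (z.2 * w.1 - z.1 * w.2) + (z.1 * w.2 + z.2 * (w.1 + w.2)) by ring]
        exact dvd_add h1 h2
      refine ⟨hz, (hpp.dvd_or_dvd (b := w.2) ?_).resolve_right hv, hz2⟩
      exact (dvd_sub_right (hz2.mul_right _)).1 h1
    · rintro ⟨hz, h1, h2⟩
      rw [Set.mem_inter_iff, mem1 hz, mem2 hz]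
      exact ⟨dvd_sub (h2.mul_right _) (h1.mul_right _), dvd_add (h1.mul_right _) (h2.mul_right _)⟩
  have hcard := Set.ncard_union_add_ncard_inter (hexMul w '' hexRep n)
    (hexMul (hexConj w) '' hexRep n) ((finite_hexRep _).image _) ((finite_hexRep _).image _)
  rw [hunion, hinter, ncard_setOf_dvd hp.ne_zero, ncard_image_hexMul (by rwa [hw]),
    ncard_image_hexMul (by rwa [hw'])] at hcard
  omega

/-! ### The Hecke recursion and the divisor-sum formula -/

lemma chiThree_natCast_of_mod {n r : ℕ} (h : n % 3 = r) : chiThree (n : ZMod 3) = chiThree r := by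
  rw [← h, ZMod.natCast_mod]

/-- Hecke relation for the number of representations by `b² + bc + c²`. -/
lemma ncard_hexRep_prime_mul {p : ℕ} (hp : p.Prime) (n : ℕ) :
    ((hexRep ((p * n : ℕ) : ℤ)).ncard : ℤ) =
      (1 + chiThree p) * (hexRep n).ncard - chiThree p * hexRepDiv n p := by
  push_cast
  have h3 : p % 3 < 3 := Nat.mod_lt _ (by norm_num)
  obtain h | h | h : p % 3 = 0 ∨ p % 3 = 1 ∨ p % 3 = 2 := by omega
  · obtain rfl : 3 = p := (Nat.prime_dvd_prime_iff_eq Nat.prime_three hp).1 (by omega)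
    rw [chiThree_natCast_of_mod h, show chiThree ((0 : ℕ) : ZMod 3) = 0 from rfl]
    have := ncard_hexRep_three_mul n
    push_cast
    rw [this]; ring
  · rw [chiThree_natCast_of_mod h, show chiThree ((1 : ℕ) : ZMod 3) = 1 from rfl]
    have := ncard_hexRep_split hp h n
    omega
  · rw [chiThree_natCast_of_mod h, show chiThree ((2 : ℕ) : ZMod 3) = -1 from rfl]
    rw [ncard_hexRep_inert hp h n]; ring

/-- Hecke relation for the divisor sum of `chiThree`. -/
lemma sum_divisors_chiThree_prime_mul {p n : ℕ} (hp : p.Prime) (hn : n ≠ 0) :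
    ∑ d ∈ (p * n).divisors, chiThree d =
      (1 + chiThree p) * ∑ d ∈ n.divisors, chiThree d -
        chiThree p * if p ∣ n then ∑ d ∈ (n / p).divisors, chiThree d else 0 := by
  have hinj : Function.Injective (p * · : ℕ → ℕ) := mul_right_injective₀ hp.ne_zero
  have himage (s : Finset ℕ) :
      ∑ d ∈ s.image (p * ·), chiThree d = chiThree p * ∑ d ∈ s, chiThree d := by
    rw [Finset.sum_image fun _ _ _ _ h => hinj h, Finset.mul_sum]
    simp
  have hunion : (p * n).divisors = n.divisors ∪ n.divisors.image (p * ·) := by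
    ext d
    simp only [Nat.mem_divisors, Finset.mem_union, Finset.mem_image]
    constructor
    · rintro ⟨hd, -⟩
      by_cases hpd : p ∣ d
      · obtain ⟨e, rfl⟩ := hpd
        exact Or.inr ⟨e, ⟨Nat.dvd_of_mul_dvd_mul_left hp.pos hd, hn⟩, rfl⟩
      · exact Or.inl ⟨((hp.coprime_iff_not_dvd.2 hpd).symm).dvd_of_dvd_mul_left hd, hn⟩
    · rintro (⟨hd, -⟩ | ⟨e, ⟨hd, -⟩, rfl⟩)
      · exact ⟨hd.mul_left _, mul_ne_zero hp.ne_zero hn⟩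
      · exact ⟨mul_dvd_mul_left _ hd, mul_ne_zero hp.ne_zero hn⟩
  have hinter : ∑ d ∈ n.divisors ∩ n.divisors.image (p * ·), chiThree d =
      chiThree p * if p ∣ n then ∑ d ∈ (n / p).divisors, chiThree d else 0 := by
    split_ifs with h
    · obtain ⟨m, rfl⟩ := h
      rw [Nat.mul_div_cancel_left _ hp.pos, ← himage]
      congr 1
      have hm : m ≠ 0 := right_ne_zero_of_mul hn
      ext d
      simp only [Nat.mem_divisors, Finset.mem_inter, Finset.mem_image]
      constructor
      · rintro ⟨⟨h1, -⟩, e, -, rfl⟩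
        exact ⟨e, ⟨Nat.dvd_of_mul_dvd_mul_left hp.pos h1, hm⟩, rfl⟩
      · rintro ⟨e, ⟨h1, -⟩, rfl⟩
        exact ⟨⟨mul_dvd_mul_left _ h1, hn⟩, e, ⟨h1.mul_left _, hn⟩, rfl⟩
    · rw [mul_zero]
      convert Finset.sum_empty
      ext d
      simp only [Nat.mem_divisors, Finset.mem_inter, Finset.mem_image, Finset.notMem_empty,
        iff_false]
      rintro ⟨⟨h1, -⟩, e, -, rfl⟩
      exact h (dvd_of_mul_right_dvd h1)
  have := Finset.sum_union_inter (s₁ := n.divisors) (s₂ := n.divisors.image (p * ·))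
    (f := fun d : ℕ => chiThree d)
  rw [← hunion, hinter, himage] at this
  linarith

/-- The number of representations of `n ≥ 1` by `b² + bc + c²` is `6 ∑_{d ∣ n} χ₃(d)`. -/
theorem ncard_hexRep (n : ℕ) (hn : n ≠ 0) :
    ((hexRep n).ncard : ℤ) = 6 * ∑ d ∈ n.divisors, chiThree d := by
  induction n using Nat.strong_induction_on with
  | _ n ih =>
    by_cases h1 : n = 1
    · subst h1
      simp [ncard_hexRep_one]
    · obtain ⟨p, hp, m, rfl⟩ := Nat.exists_prime_and_dvd h1
      have hm : m ≠ 0 := right_ne_zero_of_mul hn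
      have hlt : m < p * m := lt_mul_of_one_lt_left (Nat.pos_of_ne_zero hm) hp.one_lt
      rw [ncard_hexRep_prime_mul hp, sum_divisors_chiThree_prime_mul hp hm, ih m hlt hm, hexRepDiv]
      split_ifs with h
      · have hm' : m / p ≠ 0 := (Nat.div_pos (Nat.le_of_dvd (Nat.pos_of_ne_zero hm) h) hp.pos).ne'
        rw [ih (m / p) ((Nat.div_le_self _ _).trans_lt hlt) hm']
        ring
      · push_cast; ring

/-! ### Theta and Lambert series -/

lemma summable_pow_hexNorm {q : ℂ} (hq : ‖q‖ < 1) :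
    Summable fun z : ℤ × ℤ => q ^ hexNorm z := by
  -- The square root absorbs the factor 2 in |b| + |c| ≤ 2N.
  set ρ := √‖q‖ with hρ
  have hρ0 : 0 ≤ ρ := Real.sqrt_nonneg _
  have hρ1 : ρ < 1 := by rwa [hρ, Real.sqrt_lt' one_pos, one_pow]
  have hρ2 : ρ ^ 2 = ‖q‖ := Real.sq_sqrt (norm_nonneg q)
  have hgeom : Summable fun n : ℕ => ρ ^ n := summable_geometric_of_lt_one hρ0 hρ1
  have hint : Summable fun b : ℤ => ρ ^ b.natAbs := by
    apply Summable.of_nat_of_neg <;> simpa using hgeom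
  have hprod := hint.mul_of_nonneg hint (fun _ => by positivity) (fun _ => by positivity)
  refine Summable.of_norm_bounded hprod fun z => ?_
  obtain ⟨n, hn⟩ := Int.eq_ofNat_of_zero_le (hexNorm_nonneg z)
  have h := abs_add_abs_le_two_mul_hexNorm z
  rw [Int.abs_eq_natAbs, Int.abs_eq_natAbs] at h
  rw [hn, zpow_natCast, norm_pow, ← hρ2, ← pow_mul, ← pow_add]
  apply pow_le_pow_of_le_one hρ0 hρ1.le
  omega

/-- The theta series of `b² + bc + c²`, grouped by the value of the form. -/
lemma hasSum_ncard_hexRep_mul_pow {q : ℂ} (hq : ‖q‖ < 1) :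
    HasSum (fun n : ℕ => ((hexRep n).ncard : ℂ) * q ^ n) (∑' z : ℤ × ℤ, q ^ hexNorm z) := by
  have h := (summable_pow_hexNorm hq).hasSum.tsum_fiberwise fun z => (hexNorm z).toNat
  refine (congrArg (HasSum · _) (funext fun n => ?_)).mp h
  have hset : (fun z => (hexNorm z).toNat) ⁻¹' {n} = hexRep n := by
    ext z
    have := hexNorm_nonneg z
    simp only [Set.mem_preimage, Set.mem_singleton_iff, hexRep, Set.mem_ofPred_eq]
    omega
  rw [hset]
  have hval (z : hexRep n) : q ^ hexNorm z = q ^ n := by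
    rw [show hexNorm z = n from z.2, zpow_natCast]
  simp_rw [hval]
  rw [tsum_const, nsmul_eq_mul, Nat.card_coe_set_eq]

lemma summable_chiThree_mul_lambert {q : ℂ} (hq : ‖q‖ < 1) :
    Summable fun n : ℕ => (chiThree n : ℂ) * (q ^ n / (1 - q ^ n)) := by
  have h := (summable_norm_pow_mul_geometric_div_one_sub 0 hq).norm
  refine Summable.of_norm_bounded h fun n => ?_
  have hχ : ∀ a : ZMod 3, |chiThree a| ≤ 1 := by decide
  rw [norm_mul, Complex.norm_intCast]
  have : ((|chiThree n| : ℤ) : ℝ) ≤ 1 := by exact_mod_cast hχ n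
  rw [Int.cast_abs] at this
  simpa using mul_le_mul_of_nonneg_right this (norm_nonneg (q ^ n / (1 - q ^ n)))

lemma tsum_chiThree_mul_lambert {q : ℂ} (hq : ‖q‖ < 1) :
    ∑' n : ℕ+, (chiThree (n : ℕ) : ℂ) * (q ^ (n : ℕ) / (1 - q ^ (n : ℕ))) =
      ∑' n : ℕ+, ((∑ d ∈ (n : ℕ).divisors, chiThree d : ℤ) : ℂ) * q ^ (n : ℕ) := by
  have hχ : ∀ a : ZMod 3, |chiThree a| ≤ 1 := by decide
  have hsum : Summable fun c : ℕ+ × ℕ+ => (chiThree (c.1 : ℕ) : ℂ) * q ^ (c.1 * c.2 : ℕ) := by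
    refine Summable.of_norm_bounded (summable_prod_mul_pow 0 hq).norm fun c => ?_
    rw [norm_mul, Complex.norm_intCast]
    have : ((|chiThree (c.1 : ℕ)| : ℤ) : ℝ) ≤ 1 := by exact_mod_cast hχ _
    rw [Int.cast_abs] at this
    simpa using mul_le_mul_of_nonneg_right this (norm_nonneg (q ^ (c.1 * c.2 : ℕ)))
  have hrow (n : ℕ+) : (chiThree (n : ℕ) : ℂ) * (q ^ (n : ℕ) / (1 - q ^ (n : ℕ))) =
      ∑' c : ℕ+, (chiThree (n : ℕ) : ℂ) * q ^ (n * c : ℕ) := by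
    have hn : ‖q ^ (n : ℕ)‖ < 1 := by
      rw [norm_pow]; exact pow_lt_one₀ (norm_nonneg _) hq n.ne_zero
    rw [tsum_mul_left, tsum_pnat_eq_tsum_succ (f := fun c => q ^ (n * c : ℕ))]
    simp_rw [pow_mul, pow_succ]
    rw [tsum_mul_right, tsum_geometric_of_norm_lt_one hn]
    ring
  simp_rw [hrow]
  have hsigma := (sigmaAntidiagonalEquivProd.summable_iff.2 hsum).tsum_sigma
  simp only [Function.comp_def] at hsigma
  -- Regroups the pairs (d, e) by their product n = de.
  rw [← hsum.tsum_prod, ← sigmaAntidiagonalEquivProd.tsum_eq, hsigma]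
  refine tsum_congr fun n => ?_
  have hdiv := Nat.sum_divisorsAntidiagonal (n := n)
    fun x y => (chiThree x : ℂ) * q ^ (x * y : ℕ)
  rw [tsum_fintype]
  refine ((n : ℕ).divisorsAntidiagonal.sum_coe_sort
    fun x : ℕ × ℕ => (chiThree x.1 : ℂ) * q ^ (x.1 * x.2)).trans ?_
  rw [hdiv, Int.cast_sum, Finset.sum_mul]
  exact Finset.sum_congr rfl fun d hd => by rw [Nat.mul_div_cancel' (Nat.dvd_of_mem_divisors hd)]

theorem mainTheorem10 (q : ℂ) (hq : ‖q‖ < 1) :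
    Summable (fun p : ℤ × ℤ => q ^ (p.1 ^ 2 + p.1 * p.2 + p.2 ^ 2)) ∧
    Summable (fun m : ℕ =>
      q ^ (3 * m + 1) / (1 - q ^ (3 * m + 1)) - q ^ (3 * m + 2) / (1 - q ^ (3 * m + 2))) ∧
    ∑' p : ℤ × ℤ, q ^ (p.1 ^ 2 + p.1 * p.2 + p.2 ^ 2) =
      1 + 6 * ∑' m : ℕ,
        (q ^ (3 * m + 1) / (1 - q ^ (3 * m + 1)) - q ^ (3 * m + 2) / (1 - q ^ (3 * m + 2))) := by
  have hS := summable_chiThree_mul_lambert hq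
  have hχ1 (m : ℕ) : chiThree ((3 * m + 1 : ℕ) : ZMod 3) = 1 :=
    chiThree_natCast_of_mod (r := 1) (by omega)
  have hχ2 (m : ℕ) : chiThree ((3 * m + 2 : ℕ) : ZMod 3) = -1 :=
    chiThree_natCast_of_mod (r := 2) (by omega)
  have hχ0 (m : ℕ) : chiThree ((3 * m : ℕ) : ZMod 3) = 0 :=
    chiThree_natCast_of_mod (r := 0) (by omega)
  have hS1 : Summable fun m : ℕ => q ^ (3 * m + 1) / (1 - q ^ (3 * m + 1)) := by
    have := hS.comp_injective (i := fun m : ℕ => 3 * m + 1) fun a b h => by simpa using h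
    refine this.congr fun m => ?_
    simp only [Function.comp, hχ1]
    simp
  have hS2 : Summable fun m : ℕ => q ^ (3 * m + 2) / (1 - q ^ (3 * m + 2)) := by
    have := (hS.comp_injective (i := fun m : ℕ => 3 * m + 2) fun a b h => by simpa using h).neg
    refine this.congr fun m => ?_
    simp only [Function.comp, hχ2]
    simp
  refine ⟨summable_pow_hexNorm hq, hS1.sub hS2, ?_⟩
  have hres : ∑' n : ℕ, (chiThree n : ℂ) * (q ^ n / (1 - q ^ n)) =
      ∑' m : ℕ, (q ^ (3 * m + 1) / (1 - q ^ (3 * m + 1)) -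
        q ^ (3 * m + 2) / (1 - q ^ (3 * m + 2))) := by
    rw [Nat.sumByResidueClasses hS 3, hS1.tsum_sub hS2, sub_eq_add_neg, ← tsum_neg]
    have huniv : (Finset.univ : Finset (ZMod 3)) = {0, 1, 2} := by decide
    rw [huniv, Finset.sum_insert (by decide), Finset.sum_insert (by decide),
      Finset.sum_singleton, show (0 : ZMod 3).val = 0 from rfl, show (1 : ZMod 3).val = 1 from rfl,
      show (2 : ZMod 3).val = 2 from rfl]
    simp_rw [zero_add, add_comm _ (3 * _), hχ0, hχ1, hχ2]
    simp
  have htheta := hasSum_ncard_hexRep_mul_pow hq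
  have hzero : hexRep (0 : ℕ) = {0} := by
    ext z
    simpa [hexRep] using hexNorm_eq_zero_iff z
  have h0 (f : ℕ → ℂ) (hf : Summable f) : ∑' n, f n = f 0 + ∑' n : ℕ+, f n :=
    (tsum_zero_pnat_eq_tsum_nat hf).symm
  change ∑' z : ℤ × ℤ, q ^ hexNorm z = _
  -- At n = 0 the theta series contributes 1, and the Lambert term is 0 since division by 1 - q⁰ = 0
  -- yields 0.
  rw [← hres, ← htheta.tsum_eq, h0 _ htheta.summable, h0 _ hS, tsum_chiThree_mul_lambert hq, hzero]
  simp only [Set.ncard_singleton, pow_zero, sub_self, div_zero, mul_zero, zero_add, Nat.cast_one,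
    mul_one]
  rw [← tsum_mul_left]
  congr 1
  refine tsum_congr fun n => ?_
  have := congrArg (Int.cast : ℤ → ℂ) (ncard_hexRep n n.ne_zero)
  rw [Int.cast_natCast] at this
  rw [this]; push_cast; ring
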